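/- For a group $G$ and a subset $S\subset G$, let $\langle\langle S\rangle\rangle$ be the normal subgroup generated by $S$. For $X\in G$ let $\|X\|_S\in\mathbb{N}_0\cup\{+\infty\}$ be the least $n\ge 0$ such that $X$ is a product of $n$ elements each of which is conjugate in $G$ to an element of $S\cup S^{-1}$ (so $\|1\|_S=0$), and $\|X\|_S=+\infty$ if $X\notin\langle\langle S\rangle\rangle$. Let ${\rm diam}(\|\cdot\|_S)$ be the least $N$ with $\|X\|_S\le N$ for all $X\in G$, or $+\infty$ if there is no such $N$, and set $$\Delta_\infty(G):=\sup\{{\rm diam}(\|\cdot\|_S)\mid S\subset G \text{ finite},\ \langle\langle S\rangle\rangle=G\},$$ with $\Delta_\infty(G)=-\infty$ if there is no such $S$. For a commutative ring $R$ let ${\rm Sp}_4(R)=\{A\in R^{4\times 4}\mid A^TJA=J\}$ with $J=\begin{pmatrix}0&I_2\\-I_2&0\end{pmatrix}$. Let $K$ be a field. 1. If $K=\mathbb{F}_2$ is the field with two elements, then $\Delta_\infty({\rm Sp}_4(K))\le 5$. 2. If $K=\mathbb{F}_4$ is the field with four elements, then $\Delta_\infty({\rm Sp}_4(K))\le 4$.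 -/

import Mathlib

open scoped Pointwise

/-- The conjugation-invariant word norm `‖X‖_S`: the least number of factors in an expression of
`X` as a product of conjugates of elements of `S ∪ S⁻¹` (the empty product being `1`), and `⊤` if
there is no such expression, i.e. if `X` is not in the normal closure of `S`. -/
noncomputable def conjWordNorm {G : Type*} [Group G] (S : Set G) (X : G) : ℕ∞ :=
  ⨅ (l : List G) (_ : (∀ a ∈ l, a ∈ Group.conjugatesOfSet (S ∪ S⁻¹)) ∧ l.prod = X),
    (l.length : ℕ∞)

/-- The ball `B_S(k) = {X ∈ G | ‖X‖_S ≤ k}`. -/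
def conjWordBall {G : Type*} [Group G] (S : Set G) (k : ℕ) : Set G :=
  {X | conjWordNorm S X ≤ (k : ℕ∞)}

/-- The diameter of `‖·‖_S`: the least `N` with `B_S(N) = G`, or `⊤` if there is no such `N`. -/
noncomputable def conjWordDiam {G : Type*} [Group G] (S : Set G) : ℕ∞ :=
  ⨅ (N : ℕ) (_ : conjWordBall S N = Set.univ), (N : ℕ∞)

/-- `Δ_∞(G)`: the supremum of the diameters of `‖·‖_S` over all finite subsets `S` of `G` that
normally generate `G`. It takes values in `ℕ ∪ {+∞} ∪ {-∞}`; the supremum of the empty set is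
`⊥`, which plays the role of `-∞`. -/
noncomputable def deltaInfty (G : Type*) [Group G] : WithBot ℕ∞ :=
  ⨆ (S : Set G) (_ : S.Finite ∧ Subgroup.normalClosure S = ⊤), ((conjWordDiam S : ℕ∞) : WithBot ℕ∞)

/-- `Sp₄(R)`: the `4 × 4` matrices over `R`, in `2 × 2` blocks of size `2`, that preserve the
standard alternating form. (Mathlib's form is given by the negative of the matrix with blocks
`0, I, -I, 0`, which defines the same group; its condition `A J Aᵀ = J` is equivalent to
`Aᵀ J A = J` by `SymplecticGroup.mem_iff'`.) -/
abbrev Sp4 (R : Type*) [CommRing R] : Type _ :=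
  Matrix.symplecticGroup (Fin 2) R

/-!
Over a perfect field `K` of characteristic two, the products of two commuting transvections in
independent directions form a single conjugacy class `C` of `Sp₄(K)`. Every `s ≠ 1` has a
commutator `s · (g s⁻¹ g⁻¹)` in `C`, so `C` lies in the ball of radius two of any normally
generating set, and `C · C` in the ball of radius four.

If `|K| ≠ 2`, every element lies in `C · C`. To see this, take `p` with `ω(p, X p) = 1` and look at
the hyperbolic plane spanned by `p` and `X p`: either it is `X`-invariant and `X` splits, or `X`
has an explicit five-parameter matrix. In both cases `X` is an explicit product of transvections,
which a good choice of `p` and of the free parameters regroups into two elements of `C`. If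
`ω(p, X p) = 0` for all `p`, then `X` is an involution that is itself an explicit product of three
commuting transvections.

If `|K| = 2`, every element is a transvection or `1` times an element of `C · C`. The group permutes
the six quadratic forms of Arf invariant one, and transvections act as transpositions, so the sign
tells which of the two occurs: elements of sign `1` lie in `C · C`, and multiplication by one
generator of sign `-1` handles the others.
-/

section ConjWordBall

open scoped commutatorElement

variable {G : Type*} [Group G] {S : Set G} {s X Y : G} {m n : ℕ}

theorem mem_conjWordBall_iff : X ∈ conjWordBall S n ↔ ∃ l : List G,
    ((∀ a ∈ l, a ∈ Group.conjugatesOfSet (S ∪ S⁻¹)) ∧ l.prod = X) ∧ l.length ≤ n := by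
  rw [conjWordBall, Set.mem_ofPred_eq, ← ENat.lt_add_one_iff (ENat.natCast_ne_top n),
    conjWordNorm]
  simp only [iInf_lt_iff, exists_prop]
  simp only [ENat.lt_add_one_iff (ENat.natCast_ne_top n), Nat.cast_le]

theorem conjWordBall_mono (h : m ≤ n) : conjWordBall S m ⊆ conjWordBall S n :=
  fun _ hX =>
    let ⟨l, hl, hm⟩ := mem_conjWordBall_iff.1 hX
    mem_conjWordBall_iff.2 ⟨l, hl, hm.trans h⟩

theorem mul_mem_conjWordBall (hX : X ∈ conjWordBall S m) (hY : Y ∈ conjWordBall S n) :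
    X * Y ∈ conjWordBall S (m + n) := by
  obtain ⟨l, ⟨hl, rfl⟩, hm⟩ := mem_conjWordBall_iff.1 hX
  obtain ⟨l', ⟨hl', rfl⟩, hn⟩ := mem_conjWordBall_iff.1 hY
  exact mem_conjWordBall_iff.2 ⟨l ++ l', ⟨List.forall_mem_append.2 ⟨hl, hl'⟩, List.prod_append⟩,
    List.length_append.trans_le (Nat.add_le_add hm hn)⟩

theorem mem_conjWordBall_one (hs : s ∈ S ∪ S⁻¹) (h : IsConj s X) : X ∈ conjWordBall S 1 :=
  mem_conjWordBall_iff.2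
    ⟨[X], ⟨by simpa using Group.mem_conjugatesOfSet_iff.2 ⟨s, hs, h⟩, List.prod_singleton⟩, le_rfl⟩

theorem mem_conjWordBall_two_of_isConj_commutator {g : G} (hs : s ∈ S) (h : IsConj ⁅s, g⁆ X) :
    X ∈ conjWordBall S 2 := by
  obtain ⟨c, rfl⟩ := isConj_iff.1 h
  have hprod : c * ⁅s, g⁆ * c⁻¹ = c * s * c⁻¹ * (c * g * s⁻¹ * (c * g)⁻¹) := by
    rw [commutatorElement_def]
    group
  rw [hprod]
  exact mul_mem_conjWordBall (mem_conjWordBall_one (.inl hs) (isConj_iff.2 ⟨c, rfl⟩))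
    (mem_conjWordBall_one (.inr (Set.inv_mem_inv.2 hs)) (isConj_iff.2 ⟨c * g, rfl⟩))

theorem deltaInfty_le (h : ∀ S : Set G, Subgroup.normalClosure S = ⊤ → conjWordBall S n = .univ) :
    deltaInfty G ≤ n :=
  iSup₂_le fun S hS => WithBot.coe_le_coe.2 (iInf₂_le n (h S hS.2))

theorem exists_mem_notMem_of_normalClosure_eq_top (hS : Subgroup.normalClosure S = ⊤)
    {N : Subgroup G} [N.Normal] (hN : N ≠ ⊤) : ∃ s ∈ S, s ∉ N := by
  by_contra! h
  exact hN (top_le_iff.1 (hS.symm.trans_le (Subgroup.normalClosure_le_normal h)))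

end ConjWordBall

namespace Sp4

open Matrix
open scoped commutatorElement

section Ring

variable {R : Type*} [CommRing R]

/-- The free module of rank four on which `Sp₄(R)` acts. -/
abbrev Vec (R : Type*) := Fin 2 ⊕ Fin 2 → R

/-- The standard alternating form preserved by `Sp₄(R)`, written `ω` in the comments. -/
def form : LinearMap.BilinForm R (Vec R) := toBilin' (J (Fin 2) R)

theorem form_eq_dotProduct (x y : Vec R) : form x y = x ⬝ᵥ (J (Fin 2) R *ᵥ y) :=
  toBilin'_apply' _ _ _

theorem form_apply (x y : Vec R) : form x y =
    x (.inr 0) * y (.inl 0) + x (.inr 1) * y (.inl 1) -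
      (x (.inl 0) * y (.inr 0) + x (.inl 1) * y (.inr 1)) := by
  simp only [form_eq_dotProduct, J, fromBlocks_mulVec, zero_mulVec, neg_mulVec, one_mulVec,
    zero_add, add_zero, dotProduct, Fintype.sum_sum_type, Fin.sum_univ_two, Sum.elim_inl,
    Sum.elim_inr, Pi.neg_apply, Function.comp_apply]
  ring

theorem form_isAlt : (form : LinearMap.BilinForm R (Vec R)).IsAlt := fun x => by
  rw [form_apply]; ring

theorem form_smul_smul (g : Sp4 R) (x y : Vec R) : form (g • x) (g • y) = form x y := by
  change form (g.1 *ᵥ x) (g.1 *ᵥ y) = _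
  rw [form_eq_dotProduct, dotProduct_mulVec, vecMul_mulVec, ← dotProduct_mulVec, mulVec_mulVec,
    SymplecticGroup.mem_iff'.1 g.2, form_eq_dotProduct]

theorem ext_smul {g h : Sp4 R} (H : ∀ x : Vec R, g • x = h • x) : g = h :=
  Subtype.ext (ext_iff_smul.2 H)

/-- The element of `Sp₄(R)` given by a linear isometry of the standard alternating form. -/
def ofIsometry (f : Vec R →ₗ[R] Vec R) (h : ∀ x y, form (f x) (f y) = form x y) : Sp4 R :=
  ⟨LinearMap.toMatrix' f, by
    rw [SymplecticGroup.mem_iff']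
    refine ext_iff_mulVec.2 fun y => dotProduct_eq _ _ fun x => ?_
    rw [dotProduct_comm, dotProduct_comm _ x, ← form_eq_dotProduct, ← h x y, form_eq_dotProduct,
      Matrix.mul_assoc, ← mulVec_mulVec, ← mulVec_mulVec, dotProduct_mulVec, vecMul_transpose,
      LinearMap.toMatrix'_mulVec, LinearMap.toMatrix'_mulVec]⟩

theorem ofIsometry_smul (f : Vec R →ₗ[R] Vec R) (h : ∀ x y, form (f x) (f y) = form x y)
    (x : Vec R) : ofIsometry f h • x = f x :=
  LinearMap.toMatrix'_mulVec f x

/-- The symplectic transvection `x ↦ x + ω(v, x) v`. -/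
def transvection (v : Vec R) : Sp4 R :=
  ofIsometry (LinearMap.transvection (form v) v) fun x y => by
    simp only [LinearMap.transvection.apply, map_add, map_smul, LinearMap.add_apply,
      LinearMap.smul_apply, smul_eq_mul, form_isAlt v, ← form_isAlt.neg_eq v x]
    ring

theorem transvection_smul (v x : Vec R) : transvection v • x = x + form v x • v :=
  ofIsometry_smul _ _ x

theorem conj_transvection (g : Sp4 R) (v : Vec R) :
    g * transvection v * g⁻¹ = transvection (g • v) := by
  rw [mul_inv_eq_iff_eq_mul]
  refine ext_smul fun x => ?_
  rw [mul_smul, mul_smul, transvection_smul, transvection_smul, form_smul_smul, smul_add,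
    smul_comm]

theorem transvection_zero : transvection (0 : Vec R) = 1 :=
  ext_smul fun x => by rw [transvection_smul, smul_zero, add_zero, one_smul]

theorem commute_transvection {v w : Vec R} (h : form v w = 0) :
    Commute (transvection v) (transvection w) :=
  ext_smul fun x => by
    have h' : form w v = 0 := by rw [← form_isAlt.neg_eq, h, neg_zero]
    simp only [mul_smul, transvection_smul, map_add, map_smul, smul_eq_mul, h, h', mul_zero,
      add_zero]
    exact add_right_comm _ _ _

/-- The vectors `p, q, r, s` form a symplectic basis with hyperbolic pairs `(p, r)` and `(q, s)`. -/
structure IsSymplecticBasis (p q r s : Vec R) : Prop where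
  pq : form p q = 0
  pr : form p r = 1
  ps : form p s = 0
  qr : form q r = 0
  qs : form q s = 1
  rs : form r s = 0

namespace IsSymplecticBasis

variable {p q r s p' q' r' s' : Vec R}

theorem pairings (hb : IsSymplecticBasis p q r s) :
    (form p p = 0 ∧ form p q = 0 ∧ form p r = 1 ∧ form p s = 0) ∧
    (form q p = 0 ∧ form q q = 0 ∧ form q r = 0 ∧ form q s = 1) ∧
    (form r p = -1 ∧ form r q = 0 ∧ form r r = 0 ∧ form r s = 0) ∧
    (form s p = 0 ∧ form s q = -1 ∧ form s r = 0 ∧ form s s = 0) := by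
  simp only [← form_isAlt.neg_eq p q, ← form_isAlt.neg_eq p r, ← form_isAlt.neg_eq p s,
    ← form_isAlt.neg_eq q r, ← form_isAlt.neg_eq q s, ← form_isAlt.neg_eq r s, form_isAlt _,
    hb.pq, hb.pr, hb.ps, hb.qr, hb.qs, hb.rs, neg_zero, and_self]

theorem exists_smul_eq_sum (hb : IsSymplecticBasis p q r s) : ∃ g : Sp4 R, ∀ x : Vec R,
    g • x = x (.inr 0) • p + x (.inr 1) • q + x (.inl 0) • r + x (.inl 1) • s := by
  refine ⟨ofIsometry
    { toFun := fun x => x (.inr 0) • p + x (.inr 1) • q + x (.inl 0) • r + x (.inl 1) • s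
      map_add' := fun x y => by simp only [Pi.add_apply]; module
      map_smul' := fun c x => by simp only [Pi.smul_apply, RingHom.id_apply]; module }
    fun x y => ?_, fun x => ofIsometry_smul _ _ _⟩
  simp only [LinearMap.coe_mk, AddHom.coe_mk, map_add, map_smul, LinearMap.add_apply,
    LinearMap.smul_apply, smul_eq_mul, hb.pairings, form_apply x y]
  ring

theorem eq_sum (hb : IsSymplecticBasis p q r s) (x : Vec R) :
    x = form x r • p + form x s • q + form p x • r + form q x • s := by
  obtain ⟨g, hg⟩ := hb.exists_smul_eq_sum
  have hx := (smul_inv_smul g x).symm.trans (hg _)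
  generalize g⁻¹ • x = y at hx
  subst hx
  simp [hb.pairings]

theorem ext_smul (hb : IsSymplecticBasis p q r s) {X Y : Sp4 R} (hp : X • p = Y • p)
    (hq : X • q = Y • q) (hr : X • r = Y • r) (hs : X • s = Y • s) : X = Y :=
  Sp4.ext_smul fun x => by
    rw [hb.eq_sum x]
    simp only [smul_add, smul_comm X, smul_comm Y, hp, hq, hr, hs]

theorem exists_smul_eq (hb : IsSymplecticBasis p q r s) (hb' : IsSymplecticBasis p' q' r' s') :
    ∃ g : Sp4 R, g • p = p' ∧ g • q = q' ∧ g • r = r' ∧ g • s = s' := by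
  obtain ⟨g, hg⟩ := hb.exists_smul_eq_sum
  obtain ⟨h, hh⟩ := hb'.exists_smul_eq_sum
  have key (x : Vec R) : (h * g⁻¹) • (x (.inr 0) • p + x (.inr 1) • q + x (.inl 0) • r +
      x (.inl 1) • s) = x (.inr 0) • p' + x (.inr 1) • q' + x (.inl 0) • r' + x (.inl 1) • s' := by
    rw [← hg, mul_smul, inv_smul_smul, hh]
  refine ⟨h * g⁻¹, ?_, ?_, ?_, ?_⟩
  · simpa using key (Pi.single (.inr 0) 1)
  · simpa using key (Pi.single (.inr 1) 1)
  · simpa using key (Pi.single (.inl 0) 1)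
  · simpa using key (Pi.single (.inl 1) 1)

end IsSymplecticBasis

end Ring

section Field

variable {K : Type*} [Field K]

theorem form_nondegenerate : (form : LinearMap.BilinForm K (Vec K)).Nondegenerate :=
  LinearMap.BilinForm.nondegenerate_toBilin'_of_det_ne_zero' _
    (isUnit_det_J (Fin 2) K).ne_zero

theorem exists_form_eq {ι : Type*} {v : ι → Vec K} (hv : LinearIndependent K v) (c : ι → K) :
    ∃ x, ∀ i, form (v i) x = c i := by
  obtain ⟨f, hf⟩ := (Finsupp.linearCombination K c ∘ₗ hv.repr).exists_extend
  have hfv (i : ι) : f (v i) = c i := by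
    have := LinearMap.congr_fun hf ⟨v i, Submodule.subset_span (Set.mem_range_self i)⟩
    simpa [hv.repr_eq_single i] using this
  refine ⟨(LinearMap.BilinForm.toDual form.flip form_nondegenerate.flip).symm f, fun i => ?_⟩
  rw [← hfv]
  exact LinearMap.BilinForm.apply_toDual_symm_apply (hB := form_nondegenerate.flip) f (v i)

theorem exists_form_eq_one {p : Vec K} (hp : p ≠ 0) : ∃ r, form p r = 1 := by
  obtain ⟨r, hr⟩ := exists_form_eq (v := ![p]) (by simpa [linearIndependent_unique_iff]) ![1]
  exact ⟨r, hr 0⟩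

theorem exists_isSymplecticBasis_of_ne_zero {p q r : Vec K} (hpr : form p r = 1)
    (hpq : form p q = 0) (hqr : form q r = 0) (hq : q ≠ 0) : ∃ s, IsSymplecticBasis p q r s := by
  obtain ⟨s, hs⟩ := exists_form_eq_one hq
  refine ⟨s + form r s • p - form p s • r, hpq, hpr, ?_, hqr, ?_, ?_⟩ <;>
  simp [form_isAlt _, ← form_isAlt.neg_eq p q, ← form_isAlt.neg_eq p r, hpr, hpq, hqr, hs]

theorem exists_isSymplecticBasis_of_form_eq_one {p r : Vec K} (hpr : form p r = 1) :
    ∃ q s, IsSymplecticBasis p q r s := by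
  have hker : LinearMap.ker ((form p).prod (form r)) ≠ ⊥ :=
    LinearMap.ker_ne_bot_of_finrank_lt (by simp)
  obtain ⟨q, hq, hq0⟩ := Submodule.exists_mem_ne_zero_of_ne_bot hker
  obtain ⟨hpq, hrq⟩ : form p q = 0 ∧ form r q = 0 := Prod.mk.inj (LinearMap.mem_ker.1 hq)
  have hqr : form q r = 0 := by rw [← form_isAlt.neg_eq, hrq, neg_zero]
  obtain ⟨s, hs⟩ := exists_isSymplecticBasis_of_ne_zero hpr hpq hqr hq0
  exact ⟨q, s, hs⟩

theorem exists_isSymplecticBasis_of_linearIndependent {p q : Vec K}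
    (h : LinearIndependent K ![p, q]) (hpq : form p q = 0) :
    ∃ r s, IsSymplecticBasis p q r s := by
  obtain ⟨r, hr⟩ := exists_form_eq h ![1, 0]
  obtain ⟨s, hs⟩ := exists_form_eq h ![0, 1]
  have hpr : form p r = 1 := hr 0
  have hqr : form q r = 0 := hr 1
  have hps : form p s = 0 := hs 0
  have hqs : form q s = 1 := hs 1
  refine ⟨r - form r s • q, s, hpq, ?_, hps, ?_, hqs, ?_⟩ <;>
  simp [form_isAlt _, hpq, hpr, hqr, hqs]

theorem form_smul_eq_zero_of_smul_smul_eq {X : Sp4 K} {p x : Vec K} {a : K}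
    (hp : X • X • p = p + a • X • p) (hpx : form p x = 0) (hrx : form (X • p) x = 0) :
    form p (X • x) = 0 ∧ form (X • p) (X • x) = 0 := by
  have hr : form (X • p) (X • x) = 0 := by rw [form_smul_smul, hpx]
  have h := form_smul_smul X (X • p) x
  rw [hp, hrx] at h
  simpa [hr] using h

theorem exists_form_ne_zero_and_form_ne_zero {x y : Vec K} (hx : x ≠ 0) (hy : y ≠ 0) :
    ∃ r, form x r ≠ 0 ∧ form y r ≠ 0 := by
  obtain ⟨u, hu⟩ := exists_form_eq_one hx
  obtain ⟨v, hv⟩ := exists_form_eq_one hy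
  by_cases hyu : form y u = 0
  · by_cases hxv : form x v = 0
    · exact ⟨u + v, by simp [hu, hxv], by simp [hv, hyu]⟩
    · exact ⟨v, hxv, by simp [hv]⟩
  · exact ⟨u, by simp [hu], hyu⟩

theorem smul_add_smul_ne_zero {p r : Vec K} (hpr : form p r = 1) (a : K) {b : K} (hb : b ≠ 0) :
    a • p + b • r ≠ 0 := by
  intro h0
  have := congr_arg (form p) h0
  simp [form_isAlt _, hpr, hb] at this

theorem eq_zero_or_eq_one_of_card_eq_two (hK : Nat.card K = 2) (k : K) : k = 0 ∨ k = 1 :=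
  or_iff_not_imp_left.2 fun hk =>
    ((Nat.card_eq_two_iff' 0).1 hK).unique hk one_ne_zero

theorem transvection_ne_one {v : Vec K} (hv : v ≠ 0) : transvection v ≠ 1 := by
  intro h
  obtain ⟨x, hx⟩ := exists_form_eq_one hv
  have := transvection_smul v x
  rw [h, one_smul, hx, one_smul, left_eq_add] at this
  exact hv this

instance : Nontrivial (Sp4 K) :=
  let ⟨_, hv⟩ := exists_ne (0 : Vec K)
  ⟨_, _, transvection_ne_one hv⟩

variable (K) in
/-- The products of two commuting transvections in linearly independent directions. They form one
conjugacy class of `Sp₄(K)`. -/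
def doubleTransvections : Set (Sp4 K) :=
  {A | ∃ p q, LinearIndependent K ![p, q] ∧ form p q = 0 ∧ transvection p * transvection q = A}

theorem isConj_of_mem_doubleTransvections {A B : Sp4 K} (hA : A ∈ doubleTransvections K)
    (hB : B ∈ doubleTransvections K) : IsConj A B := by
  obtain ⟨p, q, hi, hpq, rfl⟩ := hA
  obtain ⟨p', q', hi', hpq', rfl⟩ := hB
  obtain ⟨r, s, hb⟩ := exists_isSymplecticBasis_of_linearIndependent hi hpq
  obtain ⟨r', s', hb'⟩ := exists_isSymplecticBasis_of_linearIndependent hi' hpq'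
  obtain ⟨g, rfl, rfl, -, -⟩ := hb.exists_smul_eq hb'
  exact isConj_iff.2 ⟨g, by rw [← conj_mul, conj_transvection, conj_transvection]⟩

theorem conj_mem_doubleTransvections {A : Sp4 K} (hA : A ∈ doubleTransvections K) (g : Sp4 K) :
    g * A * g⁻¹ ∈ doubleTransvections K := by
  obtain ⟨p, q, hi, hpq, rfl⟩ := hA
  refine ⟨g • p, g • q, ?_, by rw [form_smul_smul, hpq], ?_⟩
  · rw [LinearIndependent.pair_iff] at hi ⊢
    intro a b h
    rw [← smul_comm g, ← smul_comm g, ← smul_add, smul_eq_zero_iff_eq] at h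
    exact hi a b h
  · rw [← conj_mul, conj_transvection, conj_transvection]

theorem linearIndependent_of_form_eq_zero {p q r : Vec K} (hpr : form p r ≠ 0)
    (hqr : form q r = 0) (hq : q ≠ 0) : LinearIndependent K ![p, q] := by
  refine LinearIndependent.pair_symm_iff.1 ((LinearIndependent.pair_iff' hq).2 ?_)
  rintro c rfl
  simp [hqr] at hpr

theorem mem_doubleTransvections {p q r s : Vec K} (hpq : form p q = 0) (hpr : form p r ≠ 0)
    (hqr : form q r = 0) (hqs : form q s ≠ 0) :
    transvection p * transvection q ∈ doubleTransvections K :=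
  ⟨p, q, linearIndependent_of_form_eq_zero hpr hqr (by rintro rfl; simp at hqs), hpq, rfl⟩

theorem mem_range_transvection_mul_of_mem {A : Sp4 K}
    (hA : A ∈ doubleTransvections K * doubleTransvections K) :
    A ∈ Set.range transvection * (doubleTransvections K * doubleTransvections K) :=
  ⟨1, ⟨0, transvection_zero⟩, A, hA, one_mul A⟩

namespace IsSymplecticBasis

variable {p q r s : Vec K}

theorem transvection_mul_mem (hb : IsSymplecticBasis p q r s) {a b a' b' c d c' d' : K}
    (hbne : b ≠ 0) (hbne' : b' ≠ 0) (hd : d ≠ 0) (hd' : d' ≠ 0) :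
    transvection (a • p + b • r) * transvection (a' • p + b' • r) *
      (transvection (c • q + d • s) * transvection (c' • q + d' • s)) ∈
        doubleTransvections K * doubleTransvections K := by
  have horth : form (a' • p + b' • r) (c • q + d • s) = 0 := by simp [hb.pairings]
  rw [(commute_transvection horth).mul_mul_mul_comm]
  refine Set.mul_mem_mul (mem_doubleTransvections (r := p) (s := q) ?_ ?_ ?_ ?_)
    (mem_doubleTransvections (r := p) (s := q) ?_ ?_ ?_ ?_) <;>
  simp [hb.pairings, hbne, hbne', hd, hd']

theorem transvection_smul_mul_transvection_add_mem {α β : K} (hb : IsSymplecticBasis p q r s)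
    (hα : α ≠ 0) (hβ : β ≠ 0) :
    transvection (α • r) * transvection (α • r + β • q) ∈ doubleTransvections K :=
  mem_doubleTransvections (r := β • p + α • s) (s := s) (by simp [hb.pairings])
    (by simp [hb.pairings, hα, hβ]) (by simp [hb.pairings, mul_comm])
    (by simpa [hb.pairings])

theorem transvection_add_mul_transvection_smul_mem {α β γ : K} (hb : IsSymplecticBasis p q r s)
    (hα : α ≠ 0) (hγ : γ ≠ 0) :
    transvection (α • r + β • q) * transvection (γ • q) ∈ doubleTransvections K := by
  refine mem_doubleTransvections (r := p) (s := s) ?_ ?_ ?_ ?_ <;> simp [hb.pairings, hα, hγ]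

theorem transvection_add_mul_transvection_add_mem {γ δ : K} (hb : IsSymplecticBasis p q r s)
    (hδ : δ ≠ 0) :
    transvection (γ • q + δ • s) * transvection (p + r) ∈ doubleTransvections K := by
  refine mem_doubleTransvections (r := q) (s := p) ?_ ?_ ?_ ?_ <;> simp [hb.pairings, hδ]

theorem transvection_smul_mul_transvection_mem {γ : K} (hb : IsSymplecticBasis p q r s)
    (hγ : γ ≠ 0) : transvection (γ • q) * transvection (p + r) ∈ doubleTransvections K := by
  refine mem_doubleTransvections (r := s) (s := p) ?_ ?_ ?_ ?_ <;> simp [hb.pairings, hγ]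

end IsSymplecticBasis

/-- `X` preserves two orthogonal hyperbolic planes and acts on the first by `p ↦ r ↦ p + κ² r`, on
the second trivially or by `q ↦ s ↦ q + l² s`; these actions are written as products of two
transvections. -/
def IsSplit (X : Sp4 K) : Prop :=
  ∃ p q r s, IsSymplecticBasis p q r s ∧ ∃ κ l : K,
    X = transvection (κ • r) * transvection (p + r) ∨
      X = transvection (κ • r) * transvection (p + r) *
        (transvection (l • s) * transvection (q + s))

/-- A symplectic basis in which the matrix of `X` depends only on five parameters, available when
`ω(p, X p) = 1` and the plane spanned by `p` and `X p` is not invariant under `X`. -/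
structure IsNonsplitBasis (X : Sp4 K) (p q r s : Vec K) (a b c d e : K) : Prop
    extends IsSymplecticBasis p q r s where
  smul_p : X • p = r
  smul_r : X • r = p + q + a • r
  smul_q : X • q = b • q + d • (r + s)
  smul_s : X • s = c • q + e • (r + s)
  det_eq_one : b * e + c * d = 1

theorem IsNonsplitBasis.form_smul_smul_smul {X : Sp4 K} {p q r s : Vec K} {a b c d e : K}
    (h : IsNonsplitBasis X p q r s a b c d e) : form p (X • X • X • p) = 1 + a ^ 2 + d := by
  simp only [h.smul_p, h.smul_q, h.smul_r, smul_add, smul_comm X, map_add, map_smul,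
    smul_eq_mul, h.pairings]
  ring

end Field

section CharTwo

variable {K : Type*} [Field K] [CharP K 2]

theorem form_comm (x y : Vec K) : form x y = form y x := by
  rw [← form_isAlt.neg_eq, CharTwo.neg_eq]

theorem transvection_smul_mul_transvection_smul (a b : K) (v : Vec K) :
    transvection (a • v) * transvection (b • v) = transvection ((a + b) • v) :=
  ext_smul fun x => by
    simp only [mul_smul, transvection_smul, map_add, map_smul, LinearMap.smul_apply, smul_eq_mul,
      form_isAlt v]
    match_scalars <;> grind

theorem transvection_mul_self (v : Vec K) : transvection v * transvection v = 1 := by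
  simpa [CharTwo.add_self_eq_zero, transvection_zero] using
    transvection_smul_mul_transvection_smul 1 1 v

theorem transvection_inv (v : Vec K) : (transvection v)⁻¹ = transvection v :=
  inv_eq_of_mul_eq_one_left (transvection_mul_self v)

/-! ### Normal forms in characteristic two -/

theorem exists_isNonsplitBasis {X : Sp4 K} {p : Vec K} (hp : form p (X • p) = 1)
    (hne : X • X • p ≠ p + form p (X • X • p) • X • p) :
    ∃ q s b c d e, IsNonsplitBasis X p q (X • p) s (form p (X • X • p)) b c d e := by
  have hr := form_smul_smul X p (X • p)
  set r := X • p with hXp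
  set a := form p (X • r)
  obtain ⟨q, hq⟩ : ∃ q, X • r = p + q + a • r := ⟨X • r - p - a • r, by abel⟩
  have hpq : form p q = 0 := by
    have : a = form p (p + q + a • r) := by rw [← hq]
    simpa [form_isAlt _, hp] using this
  have hqr : form q r = 0 := by
    rw [form_comm]
    rw [hq] at hr
    simpa [form_isAlt _, hp, form_comm r p] using hr
  have hq0 : q ≠ 0 := by
    rintro rfl
    exact hne (by rw [hq, add_zero])
  obtain ⟨s, hb⟩ := exists_isSymplecticBasis_of_ne_zero hp hpq hqr hq0
  have key {x : Vec K} (hpx : form p x = 0) (hrx : form r x = 0) :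
      X • x = form (X • x) s • q + form q (X • x) • (r + s) := by
    have h1 : form r (X • x) = 0 := by rw [hXp, form_smul_smul, hpx]
    have h2 : form (X • r) (X • x) = 0 := by rw [form_smul_smul, hrx]
    have h3 : form p (X • x) = form q (X • x) := by
      rw [hq] at h2
      simp only [map_add, map_smul, LinearMap.add_apply, LinearMap.smul_apply, h1, smul_zero,
        add_zero] at h2
      exact CharTwo.add_eq_zero.1 h2
    conv_lhs => rw [hb.eq_sum (X • x), form_comm _ r, h1, h3]
    rw [smul_add, zero_smul]
    abel
  have hXq := key hb.pq ((form_comm _ _).trans hb.qr)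
  have hXs := key hb.ps hb.rs
  refine ⟨q, s, _, _, _, _, hb, rfl, hq, hXq, hXs, ?_⟩
  have hdet := form_smul_smul X q s
  rw [hXq, hXs] at hdet
  simpa [hb.pairings, CharTwo.neg_eq, mul_comm] using hdet

theorem IsSymplecticBasis.eq_transvection_mul_transvection {X : Sp4 K} {p q r s : Vec K} {κ : K}
    (hb : IsSymplecticBasis p q r s) (hp : X • p = r) (hr : X • r = p + κ ^ 2 • r)
    (hq : X • q = q) (hs : X • s = s) : X = transvection (κ • r) * transvection (p + r) := by
  apply hb.ext_smul <;>
  simp only [hp, hq, hr, hs, mul_smul, transvection_smul, map_add, map_smul, LinearMap.add_apply,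
    LinearMap.smul_apply, smul_eq_mul, hb.pairings] <;>
  match_scalars <;> grind

theorem exists_sq_eq [PerfectRing K 2] (a : K) : ∃ κ, κ ^ 2 = a :=
  surjective_frobenius K 2 a

theorem exists_form_smul_eq_one [PerfectRing K 2] {X : Sp4 K} {v : Vec K}
    (hv : form v (X • v) ≠ 0) : ∃ k : K, form (k • v) (X • k • v) = 1 := by
  obtain ⟨k, hk⟩ := exists_sq_eq (form v (X • v))⁻¹
  refine ⟨k, ?_⟩
  simp only [smul_comm X k, map_smul, LinearMap.smul_apply, smul_eq_mul]
  rw [← mul_assoc, ← pow_two, hk, inv_mul_cancel₀ hv]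

theorem smul_smul_eq_of_form_eq_one {X : Sp4 K} {p q r s : Vec K}
    (hb : IsSymplecticBasis p q r s) (hX : X • q = s) (hp : form p (X • s) = 0)
    (hr : form r (X • s) = 0) : X • s = q + form q (X • s) • s := by
  have hs : form s (X • s) = 1 := by
    conv_lhs => rw [← hX]
    rw [form_smul_smul, hX, hb.qs]
  conv_lhs => rw [hb.eq_sum (X • s)]
  rw [form_comm _ r, form_comm _ s, hp, hr, hs]
  module

theorem smul_eq_self_of_form_smul_eq_zero {X : Sp4 K} {p q r s : Vec K}
    (hb : IsSymplecticBasis p q r s)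
    (hplane : ∀ v, form p v = 0 → form r v = 0 → form p (X • v) = 0 ∧ form r (X • v) = 0)
    (hQ : ∀ v, form p v = 0 → form r v = 0 → form v (X • v) = 0) :
    X • q = q ∧ X • s = s := by
  have hrq := (form_comm r q).trans hb.qr
  have expand {v : Vec K} (hpv : form p v = 0) (hrv : form r v = 0) :
      X • v = form s (X • v) • q + form q (X • v) • s := by
    obtain ⟨hp, hr⟩ := hplane v hpv hrv
    conv_lhs => rw [hb.eq_sum (X • v), form_comm _ r, form_comm _ s, hp, hr]
    module
  have hXq := expand hb.pq hrq
  have hXs := expand hb.ps hb.rs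
  rw [hQ q hb.pq hrq] at hXq
  rw [hQ s hb.ps hb.rs] at hXs
  have hsum := hQ (q + s) (by rw [map_add, hb.pq, hb.ps, add_zero])
    (by rw [map_add, hrq, hb.rs, add_zero])
  have hqs := form_smul_smul X q s
  generalize form s (X • q) = α at *
  generalize form q (X • s) = δ at *
  rw [smul_add, hXq, hXs] at hsum
  rw [hXq, hXs] at hqs
  simp only [map_add, map_smul, LinearMap.add_apply, LinearMap.smul_apply, smul_eq_mul,
    hb.pairings] at hsum hqs
  obtain rfl : α = 1 := by
    have : (α + 1) ^ 2 = 0 := by grind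
    grind
  obtain rfl : δ = 1 := by grind
  rw [hXq, hXs]
  constructor <;> module

theorem isSplit_of_form_smul_ne_zero [PerfectRing K 2] {X : Sp4 K} {p v : Vec K} {κ : K}
    (hp : form p (X • p) = 1) (h2 : X • X • p = p + κ ^ 2 • X • p)
    (hpv : form p v = 0) (hrv : form (X • p) v = 0) (hv : form v (X • v) ≠ 0) : IsSplit X := by
  obtain ⟨k, hk⟩ := exists_form_smul_eq_one hv
  have hpq : form p (k • v) = 0 := by rw [map_smul, hpv, smul_zero]
  have hrq : form (X • p) (k • v) = 0 := by rw [map_smul, hrv, smul_zero]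
  generalize k • v = q at hk hpq hrq
  obtain ⟨hps, hrs⟩ := form_smul_eq_zero_of_smul_smul_eq h2 hpq hrq
  obtain ⟨hps', hrs'⟩ := form_smul_eq_zero_of_smul_smul_eq h2 hps hrs
  have hb : IsSymplecticBasis p q (X • p) (X • q) :=
    ⟨hpq, hp, hps, (form_comm _ _).trans hrq, hk, hrs⟩
  have hs := smul_smul_eq_of_form_eq_one hb rfl hps' hrs'
  obtain ⟨l, hl⟩ := exists_sq_eq (form q (X • X • q))
  rw [← hl] at hs
  generalize hXp : X • p = r at *
  generalize hXq : X • q = s at *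
  refine ⟨p, q, r, s, hb, κ, l, .inr (hb.ext_smul ?_ ?_ ?_ ?_)⟩ <;>
  simp only [hXp, hXq, hs, h2, mul_smul, transvection_smul, map_add, map_smul,
    LinearMap.add_apply, LinearMap.smul_apply, smul_eq_mul, hb.pairings] <;>
  match_scalars <;> grind

theorem isSplit_of_smul_smul_eq [PerfectRing K 2] {X : Sp4 K} {p : Vec K} {a : K}
    (hp : form p (X • p) = 1) (h2 : X • X • p = p + a • X • p) : IsSplit X := by
  obtain ⟨κ, rfl⟩ := exists_sq_eq a
  by_cases hQ : ∀ v, form p v = 0 → form (X • p) v = 0 → form v (X • v) = 0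
  · obtain ⟨q, s, hb⟩ := exists_isSymplecticBasis_of_form_eq_one hp
    obtain ⟨hq, hs⟩ := smul_eq_self_of_form_smul_eq_zero hb
      (fun v => form_smul_eq_zero_of_smul_smul_eq h2) hQ
    exact ⟨p, q, _, s, hb, κ, 0, .inl (hb.eq_transvection_mul_transvection rfl h2 hq hs)⟩
  · push Not at hQ
    obtain ⟨v, hpv, hrv, hv⟩ := hQ
    exact isSplit_of_form_smul_ne_zero hp h2 hpv hrv hv

theorem IsNonsplitBasis.isSplit [PerfectRing K 2] {X : Sp4 K} {p q r s : Vec K} {a b c e : K}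
    (h : IsNonsplitBasis X p q r s a b c 0 e) (ha : a ≠ b + e) : IsSplit X := by
  have hbe : b * e = 1 := by simpa using h.det_eq_one
  have hb : b ≠ 0 := left_ne_zero_of_mul_eq_one hbe
  have hab : b + e + a ≠ 0 := fun h0 => ha (CharTwo.add_eq_zero.1 h0).symm
  obtain ⟨k, hk⟩ : ∃ k, k * (b * (b + e + a)) = 1 := ⟨_, inv_mul_cancel₀ (mul_ne_zero hb hab)⟩
  refine isSplit_of_smul_smul_eq (p := p + k • q) (a := a) ?_ ?_ <;>
  simp only [smul_add, smul_comm X, h.smul_p, h.smul_q, h.smul_r, h.smul_s, map_add, map_smul,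
    LinearMap.add_apply, LinearMap.smul_apply, smul_eq_mul, h.pairings]
  · ring
  · match_scalars <;> grind

theorem smul_smul_eq_self {X : Sp4 K} (h : ∀ v : Vec K, form v (X • v) = 0) (v : Vec K) :
    X • X • v = v := by
  have polar (x y : Vec K) : form x (X • y) = form (X • x) y := by
    have hxy := h (x + y)
    simp only [smul_add, map_add, LinearMap.add_apply, h, zero_add, add_zero] at hxy
    rw [form_comm (X • x), CharTwo.add_eq_zero.1 hxy]
  refine sub_eq_zero.1 (form_nondegenerate.1 _ fun y => ?_)
  rw [map_sub, LinearMap.sub_apply, ← polar, form_smul_smul, sub_self]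

theorem smul_eq_self_and_form_eq_zero {X : Sp4 K} (h : ∀ v : Vec K, form v (X • v) = 0)
    {x n : Vec K} (hn : X • x = x + n) : X • n = n ∧ form x n = 0 := by
  have hx := h x
  have hxx := smul_smul_eq_self h x
  rw [hn, smul_add, hn, add_assoc, add_eq_left] at hxx
  rw [hn, map_add, form_isAlt x, zero_add] at hx
  refine ⟨(eq_neg_of_add_eq_zero_right hxx).trans ?_, hx⟩
  rw [← neg_one_smul K, CharTwo.neg_eq, one_smul]

theorem exists_eq_transvection_mul {X : Sp4 K} (h : ∀ v : Vec K, form v (X • v) = 0)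
    (hX : X ≠ 1) : ∃ p q r s, IsSymplecticBasis p q r s ∧
      X = transvection r * transvection s * transvection (r + s) := by
  obtain ⟨p, hp⟩ : ∃ p : Vec K, X • p ≠ p := by
    by_contra! hall
    exact hX (ext_smul fun x => by rw [hall, one_smul])
  obtain ⟨s, hs⟩ : ∃ s, X • p = p + s := ⟨X • p - p, by abel⟩
  have hs0 : s ≠ 0 := by
    rintro rfl
    exact hp (by rw [hs, add_zero])
  obtain ⟨q, hsq⟩ := exists_form_eq_one hs0
  obtain ⟨r, hr⟩ : ∃ r, X • q = q + r := ⟨X • q - q, by abel⟩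
  obtain ⟨hXs, hps⟩ := smul_eq_self_and_form_eq_zero h hs
  obtain ⟨hXr, hqr⟩ := smul_eq_self_and_form_eq_zero h hr
  have hsr : form s r = 0 := by
    have := form_smul_smul X s q
    rwa [hXs, hr, map_add, add_eq_left] at this
  have hpr : form p r = 1 := by
    have := form_smul_smul X p q
    simp only [hs, hr, map_add, LinearMap.add_apply, hsr, hsq, add_zero, add_assoc,
      add_eq_left] at this
    exact (CharTwo.add_eq_zero.1 this).symm
  obtain ⟨q', hb, hq'⟩ : ∃ q', IsSymplecticBasis p q' r s ∧ X • q' = q' + r := by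
    refine ⟨q + form p q • r, ?_, by rw [smul_add, smul_comm X, hr, hXr]; abel⟩
    constructor <;>
    simp [hpr, hps, hqr, hsq, hsr, form_isAlt r, form_comm q s, form_comm r s,
      CharTwo.add_self_eq_zero]
  refine ⟨_, _, _, _, hb, hb.ext_smul ?_ ?_ ?_ ?_⟩ <;>
  simp only [hs, hq', hXs, hXr, mul_smul, transvection_smul, map_add, map_smul,
    LinearMap.add_apply, smul_eq_mul, hb.pairings] <;>
  match_scalars <;> grind

theorem mul_transvection_mul_transvection_mul (X Y : Sp4 K) (v : Vec K) :
    X * transvection v * (transvection v * Y) = X * Y := by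
  rw [mul_assoc, ← mul_assoc _ _ Y, transvection_mul_self, one_mul]

theorem transvection_mul_transvection_mem {x y : Vec K} (hx : x ≠ 0) (hy : y ≠ 0) :
    transvection x * transvection y ∈ doubleTransvections K * doubleTransvections K := by
  obtain ⟨r, hxr, hyr⟩ := exists_form_ne_zero_and_form_ne_zero hx hy
  have hker : LinearMap.ker ((form x).prod ((form y).prod (form r))) ≠ ⊥ :=
    LinearMap.ker_ne_bot_of_finrank_lt (by simp)
  obtain ⟨z, hz, hz0⟩ := Submodule.exists_mem_ne_zero_of_ne_bot hker
  simp only [LinearMap.mem_ker, LinearMap.prod_apply, Function.prod_apply, Prod.mk_eq_zero] at hz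
  obtain ⟨hxz, hyz, hrz⟩ := hz
  rw [form_comm] at hyz hrz
  rw [← mul_transvection_mul_transvection_mul _ _ z]
  exact Set.mul_mem_mul ⟨x, z, linearIndependent_of_form_eq_zero hxr hrz hz0, hxz, rfl⟩
    ⟨z, y, LinearIndependent.pair_symm_iff.1 (linearIndependent_of_form_eq_zero hyr hrz hz0),
      hyz, rfl⟩

theorem one_mem_doubleTransvections_mul :
    (1 : Sp4 K) ∈ doubleTransvections K * doubleTransvections K := by
  obtain ⟨x, hx⟩ := exists_ne (0 : Vec K)
  exact transvection_mul_self x ▸ transvection_mul_transvection_mem hx hx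

theorem transvection_mul_mul_mem (x y z : Vec K) :
    transvection x * transvection y * transvection z ∈
      Set.range transvection * (doubleTransvections K * doubleTransvections K) := by
  have mem {v : Vec K} {A : Sp4 K} (hA : A ∈ doubleTransvections K * doubleTransvections K) :
      transvection v * A ∈
        Set.range transvection * (doubleTransvections K * doubleTransvections K) :=
    Set.mul_mem_mul ⟨v, rfl⟩ hA
  rw [mul_assoc]
  rcases eq_or_ne y 0 with rfl | hy <;> rcases eq_or_ne z 0 with rfl | hz
  · simpa [transvection_zero] using mem one_mem_doubleTransvections_mul
  · rcases eq_or_ne x 0 with rfl | hx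
    · simpa [transvection_zero] using mem (v := z) one_mem_doubleTransvections_mul
    · simpa [transvection_zero] using mem (v := 0) (transvection_mul_transvection_mem hx hz)
  · rcases eq_or_ne x 0 with rfl | hx
    · simpa [transvection_zero] using mem (v := y) one_mem_doubleTransvections_mul
    · simpa [transvection_zero] using mem (v := 0) (transvection_mul_transvection_mem hx hy)
  · exact mem (transvection_mul_transvection_mem hy hz)

/-- The parameters `α`, `β` and `κ` are left free so that each caller can choose which coefficients
vanish. -/
theorem IsNonsplitBasis.eq_transvection_mul {X : Sp4 K} {p q r s : Vec K}
    {a b c d e α β κ η δ : K} (h : IsNonsplitBasis X p q r s a b c d e) (hαβ : α * β = 1)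
    (hκ : (κ + α) ^ 2 = a) (hδ : δ ^ 2 = d) (hd : d ≠ 0) (hη : η ^ 2 * d = b + e) :
    X = transvection (κ • r) * transvection (α • r + β • q) * transvection ((β + η) • q) *
      transvection (((1 + e) / δ) • q + δ • s) * transvection (p + r) := by
  obtain ⟨f, hf⟩ : ∃ f, f * δ = 1 + e := ⟨(1 + e) / δ, div_mul_cancel₀ _ (by grind)⟩
  have hdet := h.det_eq_one
  rw [← hf, mul_div_cancel_right₀ _ (by grind)]
  subst hδ hκ
  apply h.ext_smul <;>
  simp only [h.smul_p, h.smul_q, h.smul_r, h.smul_s, mul_smul, transvection_smul, smul_add,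
    map_add, map_smul, LinearMap.add_apply, LinearMap.smul_apply, smul_eq_mul, h.pairings] <;>
  match_scalars <;> grind

theorem IsNonsplitBasis.eq_transvection_mul_of_eq_one {X : Sp4 K} {p q r s : Vec K}
    {c α β γ : K} (h : IsNonsplitBasis X p q r s 0 1 c 0 1) (hαβ : α * β = 1) (hγ : γ ^ 2 = c) :
    X = transvection (α • r) * transvection (α • r + β • q) * transvection ((β + γ) • q) *
      transvection (p + r) := by
  apply h.ext_smul <;>
  simp only [h.smul_p, h.smul_q, h.smul_r, h.smul_s, mul_smul, transvection_smul, smul_add,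
    map_add, map_smul, LinearMap.add_apply, LinearMap.smul_apply, smul_eq_mul, h.pairings] <;>
  match_scalars <;> grind

theorem exists_notMem_of_card_ne_two (hK : Nat.card K ≠ 2) (x y z : K) :
    ∃ k, k ≠ x ∧ k ≠ y ∧ k ≠ z := by
  obtain ⟨k, hk0, hk1⟩ : ∃ k : K, k ≠ 0 ∧ k ≠ 1 := by
    by_contra! h
    exact hK (Nat.card_eq_two_iff.2 ⟨0, 1, zero_ne_one, Set.eq_univ_of_forall fun k =>
      or_iff_not_imp_left.2 (h k)⟩)
  classical
  have hcard : ({x, y, z} : Finset K).card < ({0, 1, k, k + 1} : Finset K).card := by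
    refine Finset.card_le_three.trans_lt ?_
    rw [Finset.card_insert_of_notMem, Finset.card_insert_of_notMem, Finset.card_pair] <;> grind
  obtain ⟨w, -, hw⟩ := Finset.exists_mem_notMem_of_card_lt_card hcard
  exact ⟨w, by simpa using hw⟩

theorem isSplit_or_isNonsplitBasis [PerfectRing K 2] {X : Sp4 K} {p : Vec K}
    (hp : form p (X • p) = 1) :
    IsSplit X ∨ ∃ q s b c d e, IsNonsplitBasis X p q (X • p) s (form p (X • X • p)) b c d e ∧
      (d = 0 → form p (X • X • p) = b + e) := by
  by_cases h : X • X • p = p + form p (X • X • p) • X • p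
  · exact .inl (isSplit_of_smul_smul_eq hp h)
  obtain ⟨q, s, b, c, d, e, hX⟩ := exists_isNonsplitBasis hp h
  by_cases hd : d = 0 → form p (X • X • p) = b + e
  · exact .inr ⟨q, s, b, c, d, e, hX, hd⟩
  · push Not at hd
    obtain ⟨rfl, ha⟩ := hd
    exact .inl (hX.isSplit ha)

theorem isSplit_or_isNonsplitBasis_of_form_ne_zero [PerfectRing K 2] {X : Sp4 K} {v : Vec K}
    (h1 : form v (X • v) ≠ 0) (h2 : form v (X • X • v) ≠ 0) :
    IsSplit X ∨ ∃ p q r s a b c d e, IsNonsplitBasis X p q r s a b c d e ∧ a ≠ 0 ∧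
      (d = 0 → a = b + e ∧ form v (X • v) ^ 2 + form v (X • X • v) ^ 2 +
        form v (X • v) * form v (X • X • X • v) = 0) := by
  obtain ⟨m, hm⟩ := exists_form_smul_eq_one h1
  refine (isSplit_or_isNonsplitBasis hm).imp_right ?_
  rintro ⟨q, s, b, c, d, e, h, hd⟩
  have h3 := h.form_smul_smul_smul
  simp only [smul_comm X m, map_smul, LinearMap.smul_apply, smul_eq_mul] at hm h3
  refine ⟨_, _, _, _, _, _, _, _, _, h, ?_, fun hd0 => ⟨hd hd0, ?_⟩⟩
  · simp only [smul_comm X m, map_smul, LinearMap.smul_apply, smul_eq_mul]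
    grind
  · subst hd0
    grind

namespace IsNonsplitBasis

variable [PerfectRing K 2] {X : Sp4 K} {p q r s : Vec K} {a b c d e : K}

theorem isSplit_or_exists_of_a_ne_zero (hK : Nat.card K ≠ 2) (ha : a ≠ 0)
    (h : IsNonsplitBasis X p q r s a b c 0 e) (hbe : a = b + e) :
    IsSplit X ∨ ∃ p q r s a b c d e, IsNonsplitBasis X p q r s a b c d e ∧ a ≠ 0 ∧ d ≠ 0 := by
  subst hbe
  have he : e ≠ 0 := right_ne_zero_of_mul_eq_one (by simpa using h.det_eq_one)
  obtain ⟨θ, hθ0, hθ, -⟩ := exists_notMem_of_card_ne_two hK 0 (e / (b + e)) 0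
  -- Restart the normal form from `s + ζ q`: the first two pairings with its images are nonzero by
  -- the choice of `θ`, and the third one is incompatible with the new `d` being zero.
  obtain ⟨ζ, rfl⟩ : ∃ ζ, θ = c + ζ * (b + e) := ⟨(θ - c) / (b + e), by grind⟩
  have h1 : form (s + ζ • q) (X • (s + ζ • q)) = c + ζ * (b + e) := by
    simp only [h.smul_q, h.smul_s, smul_add, smul_comm X, map_add, map_smul,
      LinearMap.add_apply, LinearMap.smul_apply, smul_eq_mul, h.pairings]
    grind
  have h2 : form (s + ζ • q) (X • X • (s + ζ • q)) = (b + e) * (c + ζ * (b + e)) + e := by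
    simp only [h.smul_q, h.smul_r, h.smul_s, smul_add, smul_comm X, map_add, map_smul,
      LinearMap.add_apply, LinearMap.smul_apply, smul_eq_mul, h.pairings]
    grind [h.det_eq_one]
  have h3 : form (s + ζ • q) (X • X • X • (s + ζ • q)) =
      (c + ζ * (b + e)) * ((b + e) ^ 2 + 1) := by
    simp only [h.smul_p, h.smul_q, h.smul_r, h.smul_s, smul_add, smul_comm X, map_add, map_smul,
      LinearMap.add_apply, LinearMap.smul_apply, smul_eq_mul, h.pairings]
    grind [h.det_eq_one]
  refine (isSplit_or_isNonsplitBasis_of_form_ne_zero (by rwa [h1]) ?_).imp_right ?_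
  · rw [h2]
    grind
  · rintro ⟨p, q, r, s, a, b', c', d, e', h', ha', hd⟩
    refine ⟨p, q, r, s, a, b', c', d, e', h', ha', fun hd0 => he ?_⟩
    have := (hd hd0).2
    rw [h1, h2, h3] at this
    grind

theorem isSplit_or_exists_of_d_ne_zero (hK : Nat.card K ≠ 2)
    (h : IsNonsplitBasis X p q r s 0 b c d e) (hd : d ≠ 0) :
    IsSplit X ∨ ∃ p q r s a b c d e, IsNonsplitBasis X p q r s a b c d e ∧ a ≠ 0 ∧ d ≠ 0 := by
  obtain ⟨k, hk0, hk1, -⟩ := exists_notMem_of_card_ne_two hK 0 1 0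
  have h1 : form (p + k • r) (X • (p + k • r)) = (1 + k) ^ 2 := by
    simp only [h.smul_p, h.smul_r, smul_add, smul_comm X, map_add, map_smul,
      LinearMap.add_apply, LinearMap.smul_apply, smul_eq_mul, h.pairings]
    grind
  have h2 : form (p + k • r) (X • X • (p + k • r)) = k * d := by
    simp only [h.smul_p, h.smul_q, h.smul_r, smul_add, smul_comm X, map_add, map_smul,
      LinearMap.add_apply, LinearMap.smul_apply, smul_eq_mul, h.pairings]
    grind
  obtain hX | ⟨p', q', r', s', a', b', c', d', e', h', ha', hd'⟩ :=
    isSplit_or_isNonsplitBasis_of_form_ne_zero (X := X) (v := p + k • r) (by rw [h1]; grind)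
      (by rw [h2]; exact mul_ne_zero hk0 hd)
  · exact .inl hX
  by_cases hd0 : d' = 0
  · subst hd0
    exact h'.isSplit_or_exists_of_a_ne_zero hK ha' (hd' rfl).1
  · exact .inr ⟨p', q', r', s', a', b', c', d', e', h', ha', hd0⟩

end IsNonsplitBasis

/-! ### Products of double transvections over more than two elements -/

theorem exists_transvection_smul_mul_eq (hK : Nat.card K ≠ 2) (κ : K) (p r : Vec K) :
    ∃ a b a' b' : K, b ≠ 0 ∧ b' ≠ 0 ∧ transvection (κ • r) * transvection (p + r) =
      transvection (a • p + b • r) * transvection (a' • p + b' • r) := by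
  rcases eq_or_ne κ 0 with rfl | hκ
  · obtain ⟨k, hk0, hk1, -⟩ := exists_notMem_of_card_ne_two hK 0 1 0
    refine ⟨k, k, 1 + k, 1 + k, hk0, by grind, ?_⟩
    rw [← smul_add, ← smul_add, transvection_smul_mul_transvection_smul, zero_smul,
      transvection_zero, one_mul, add_left_comm, CharTwo.add_self_eq_zero, add_zero, one_smul]
  · exact ⟨0, κ, 1, 1, hκ, one_ne_zero, by rw [zero_smul, zero_add, one_smul, one_smul]⟩

theorem IsSplit.mem_doubleTransvections_mul (hK : Nat.card K ≠ 2) {X : Sp4 K}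
    (hX : IsSplit X) : X ∈ doubleTransvections K * doubleTransvections K := by
  obtain ⟨p, q, r, s, hb, κ, l, rfl | rfl⟩ := hX <;>
  obtain ⟨a, b, a', b', hb0, hb0', h⟩ := exists_transvection_smul_mul_eq hK κ p r
  · rw [h]
    exact transvection_mul_transvection_mem (smul_add_smul_ne_zero hb.pr a hb0)
      (smul_add_smul_ne_zero hb.pr a' hb0')
  · obtain ⟨c, d, c', d', hd0, hd0', h'⟩ := exists_transvection_smul_mul_eq hK l q s
    rw [h, h']
    exact hb.transvection_mul_mem hb0 hb0' hd0 hd0'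

theorem IsSymplecticBasis.transvection_mul_mul_eq {p q r s : Vec K}
    (hb : IsSymplecticBasis p q r s) (k : K) :
    transvection r * transvection s * transvection (r + s) =
      transvection (r + k • s) * transvection (k • s) *
        (transvection (r + (1 + k) • s) * transvection ((1 + k) • s)) := by
  apply hb.ext_smul <;>
  simp only [mul_smul, transvection_smul, smul_add, map_add, map_smul, LinearMap.add_apply,
    LinearMap.smul_apply, smul_eq_mul, hb.pairings] <;>
  match_scalars <;> grind

theorem mem_doubleTransvections_mul_of_forall_form_smul_eq_zero (hK : Nat.card K ≠ 2)
    {X : Sp4 K} (h : ∀ v : Vec K, form v (X • v) = 0) :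
    X ∈ doubleTransvections K * doubleTransvections K := by
  rcases eq_or_ne X 1 with rfl | hX
  · exact one_mem_doubleTransvections_mul
  obtain ⟨p, q, r, s, hb, rfl⟩ := exists_eq_transvection_mul h hX
  obtain ⟨k, hk0, hk1, -⟩ := exists_notMem_of_card_ne_two hK 0 1 0
  have hmem {c d : K} (hd : d ≠ 0) :
      transvection (r + c • s) * transvection (d • s) ∈ doubleTransvections K :=
    mem_doubleTransvections (r := p) (s := q) (by simp [hb.pairings])
      (by simp [hb.pairings]) (by simp [hb.pairings]) (by simpa [hb.pairings])
  rw [hb.transvection_mul_mul_eq k]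
  exact Set.mul_mem_mul (hmem hk0) (hmem (by grind))

theorem IsSymplecticBasis.transvection_mul_transvection_eq {y z p q : Vec K} {c d f : K}
    (hb : IsSymplecticBasis y z p q) (hf : (1 + c) * f = c * d) :
    transvection y * transvection z = transvection (c • y + d • z) *
      (transvection ((1 + c) • y + f • z) * transvection ((1 + d + f) • z)) := by
  apply hb.ext_smul <;>
  simp only [mul_smul, transvection_smul, smul_add, map_add, map_smul, LinearMap.add_apply,
    LinearMap.smul_apply, smul_eq_mul, hb.pairings] <;>
  match_scalars <;> grind

theorem transvection_mul_mul_mem_of_card_ne_two (hK : Nat.card K ≠ 2) {v y z : Vec K}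
    (hyz : form y z = 0) (hli : LinearIndependent K ![y, z]) (hvy : form v y ≠ 0)
    (hvz : form v z ≠ 0) : transvection v * transvection y * transvection z ∈
      doubleTransvections K * doubleTransvections K := by
  obtain ⟨p, q, hb⟩ := exists_isSymplecticBasis_of_linearIndependent hli hyz
  obtain ⟨k, hk0, hkm, hkn⟩ := exists_notMem_of_card_ne_two hK 0 (form v z)⁻¹
    (form v y + form v z)⁻¹
  have hg : 1 + k * form v z ≠ 0 := by grind
  have hh : 1 + k * form v y +
      k * form v z * (k * form v y) / (1 + k * form v z) ≠ 0 := by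
    have : k * (form v y + form v z) ≠ 1 := fun h => hkn (eq_inv_of_mul_eq_one_left h)
    grind
  rw [mul_assoc, hb.transvection_mul_transvection_eq (c := k * form v z) (d := k * form v y)
    (f := k * form v z * (k * form v y) / (1 + k * form v z)) (mul_div_cancel₀ _ hg), ← mul_assoc]
  refine Set.mul_mem_mul ⟨_, _, linearIndependent_of_form_eq_zero hvy ?_ ?_, ?_, rfl⟩
    (mem_doubleTransvections (r := p) (s := q) ?_ ?_ ?_ ?_)
  · simp [hb.pairings]
  · intro h0
    have := congr_arg (form p) h0
    simp [hb.pairings, hk0, hvz] at this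
  · simp only [map_add, map_smul, smul_eq_mul]
    grind
  all_goals simp [hb.pairings, hg, hh]

theorem IsNonsplitBasis.mem_doubleTransvections_mul [PerfectRing K 2] (hK : Nat.card K ≠ 2)
    {X : Sp4 K} {p q r s : Vec K} {a b c d e : K} (h : IsNonsplitBasis X p q r s a b c d e)
    (ha : a ≠ 0) (hd : d ≠ 0) : X ∈ doubleTransvections K * doubleTransvections K := by
  obtain ⟨α, rfl⟩ := exists_sq_eq a
  obtain ⟨δ, rfl⟩ := exists_sq_eq d
  obtain ⟨η, hη⟩ := exists_sq_eq ((b + e) / δ ^ 2)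
  have hα : α ≠ 0 := ne_zero_pow two_ne_zero ha
  have hδ : δ ≠ 0 := ne_zero_pow two_ne_zero hd
  rw [h.eq_transvection_mul (mul_inv_cancel₀ hα) (κ := 0) (by rw [zero_add]) rfl hd
    (by rw [hη, div_mul_cancel₀ _ hd]), zero_smul, transvection_zero, one_mul]
  by_cases hβ : α⁻¹ + η = 0
  · rw [hβ, zero_smul, transvection_zero, mul_one]
    refine transvection_mul_mul_mem_of_card_ne_two hK ?_ ?_ ?_ ?_
    · simp [h.pairings]
    · refine LinearIndependent.pair_symm_iff.1
        (linearIndependent_of_form_eq_zero (r := p) ?_ ?_ (smul_add_smul_ne_zero h.qs _ hδ)) <;>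
      simp [h.pairings]
    all_goals simp [h.pairings, hα, hδ]
  · rw [mul_assoc]
    exact Set.mul_mem_mul (h.transvection_add_mul_transvection_smul_mem hα hβ)
      (h.transvection_add_mul_transvection_add_mem hδ)

theorem IsNonsplitBasis.mem_doubleTransvections_mul_of_eq_one [PerfectRing K 2]
    (hK : Nat.card K ≠ 2) {X : Sp4 K} {p q r s : Vec K} {c : K}
    (h : IsNonsplitBasis X p q r s 0 1 c 0 1) :
    X ∈ doubleTransvections K * doubleTransvections K := by
  obtain ⟨γ, hγ⟩ := exists_sq_eq c
  obtain ⟨k, hk0, hkγ, -⟩ := exists_notMem_of_card_ne_two hK 0 γ 0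
  rw [h.eq_transvection_mul_of_eq_one (inv_mul_cancel₀ hk0) hγ, mul_assoc]
  refine Set.mul_mem_mul
    (h.transvection_smul_mul_transvection_add_mem (inv_ne_zero hk0) hk0)
    (h.transvection_smul_mul_transvection_mem ?_)
  grind

theorem mem_doubleTransvections_mul [PerfectRing K 2] (hK : Nat.card K ≠ 2) (X : Sp4 K) :
    X ∈ doubleTransvections K * doubleTransvections K := by
  by_cases hX : ∀ v : Vec K, form v (X • v) = 0
  · exact mem_doubleTransvections_mul_of_forall_form_smul_eq_zero hK hX
  push Not at hX
  obtain ⟨v, hv⟩ := hX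
  obtain ⟨m, hm⟩ := exists_form_smul_eq_one hv
  have of_isSplit_or : (IsSplit X ∨ ∃ p q r s a b c d e, IsNonsplitBasis X p q r s a b c d e ∧
      a ≠ 0 ∧ d ≠ 0) → X ∈ doubleTransvections K * doubleTransvections K := by
    rintro (hX | ⟨p, q, r, s, a, b, c, d, e, h, ha, hd⟩)
    · exact hX.mem_doubleTransvections_mul hK
    · exact h.mem_doubleTransvections_mul hK ha hd
  obtain hX | ⟨q, s, b, c, d, e, h, hd⟩ := isSplit_or_isNonsplitBasis hm
  · exact hX.mem_doubleTransvections_mul hK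
  generalize form (m • v) (X • X • m • v) = a at h hd
  rcases eq_or_ne d 0 with rfl | hd0 <;> rcases eq_or_ne a 0 with rfl | ha0
  · have he : e = 1 := by
      have := h.det_eq_one
      grind
    obtain rfl : b = 1 := by grind
    subst he
    exact h.mem_doubleTransvections_mul_of_eq_one hK
  · exact of_isSplit_or (h.isSplit_or_exists_of_a_ne_zero hK ha0 (hd rfl))
  · exact of_isSplit_or (h.isSplit_or_exists_of_d_ne_zero hK hd0)
  · exact h.mem_doubleTransvections_mul hK ha0 hd0

/-! ### Products of double transvections over two elements -/

theorem IsSplit.mem_range_transvection_mul {X : Sp4 K} (hX : IsSplit X) :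
    X ∈ Set.range transvection * (doubleTransvections K * doubleTransvections K) := by
  obtain ⟨p, q, r, s, hb, κ, l, rfl | rfl⟩ := hX
  · simpa only [transvection_zero, mul_one] using transvection_mul_mul_mem (κ • r) (p + r) 0
  rcases eq_or_ne κ 0 with rfl | hκ
  · simpa only [zero_smul, transvection_zero, one_mul, mul_assoc] using
      transvection_mul_mul_mem (p + r) (l • s) (q + s)
  rcases eq_or_ne l 0 with rfl | hl
  · simpa only [zero_smul, transvection_zero, one_mul] using
      transvection_mul_mul_mem (κ • r) (p + r) (q + s)
  · refine mem_range_transvection_mul_of_mem ?_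
    simpa only [zero_smul, zero_add, one_smul] using hb.transvection_mul_mem (a := 0) (a' := 1)
      (c := 0) (c' := 1) hκ one_ne_zero hl one_ne_zero

theorem IsNonsplitBasis.mem_range_transvection_mul [PerfectRing K 2] {X : Sp4 K}
    {p q r s : Vec K} {a b c d e : K} (h : IsNonsplitBasis X p q r s a b c d e) (hd : d ≠ 0) :
    X ∈ Set.range transvection * (doubleTransvections K * doubleTransvections K) := by
  obtain ⟨α, rfl⟩ := exists_sq_eq a
  obtain ⟨δ, rfl⟩ := exists_sq_eq d
  obtain ⟨η, hη⟩ := exists_sq_eq ((b + e) / δ ^ 2)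
  have hη' : η ^ 2 * δ ^ 2 = b + e := by rw [hη, div_mul_cancel₀ _ hd]
  have hlast := h.transvection_add_mul_transvection_add_mem (γ := (1 + e) / δ)
    (ne_zero_pow two_ne_zero hd)
  rcases eq_or_ne α 0 with rfl | hα
  · rw [h.eq_transvection_mul (mul_one 1) (κ := 1) (by grind) rfl hd hη']
    by_cases hη1 : 1 + η = 0
    · rw [hη1, zero_smul, transvection_zero, mul_one, mul_assoc]
      exact mem_range_transvection_mul_of_mem (Set.mul_mem_mul
        (h.transvection_smul_mul_transvection_add_mem one_ne_zero one_ne_zero) hlast)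
    · simp only [mul_assoc]
      rw [← mul_assoc (transvection ((1 : K) • r + _))]
      exact Set.mul_mem_mul ⟨_, rfl⟩ (Set.mul_mem_mul
        (h.transvection_add_mul_transvection_smul_mem one_ne_zero hη1) hlast)
  · rw [h.eq_transvection_mul (mul_inv_cancel₀ hα) (κ := 0) (by rw [zero_add]) rfl hd hη',
      zero_smul, transvection_zero, one_mul]
    by_cases hβ : α⁻¹ + η = 0
    · rw [hβ, zero_smul, transvection_zero, mul_one]
      exact transvection_mul_mul_mem _ _ _
    · rw [mul_assoc]
      exact mem_range_transvection_mul_of_mem (Set.mul_mem_mul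
        (h.transvection_add_mul_transvection_smul_mem hα hβ) hlast)

theorem IsNonsplitBasis.mem_range_transvection_mul_of_eq_one [PerfectRing K 2] {X : Sp4 K}
    {p q r s : Vec K} {c : K} (h : IsNonsplitBasis X p q r s 0 1 c 0 1) :
    X ∈ Set.range transvection * (doubleTransvections K * doubleTransvections K) := by
  obtain ⟨γ, hγ⟩ := exists_sq_eq c
  rw [h.eq_transvection_mul_of_eq_one (mul_one 1) hγ]
  by_cases hγ1 : 1 + γ = 0
  · rw [hγ1, zero_smul, transvection_zero, mul_one]
    exact transvection_mul_mul_mem _ _ _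
  · rw [mul_assoc]
    exact mem_range_transvection_mul_of_mem (Set.mul_mem_mul
      (h.transvection_smul_mul_transvection_add_mem one_ne_zero one_ne_zero)
      (h.transvection_smul_mul_transvection_mem hγ1))

theorem mem_range_transvection_mul [PerfectRing K 2] (hK : Nat.card K = 2) (X : Sp4 K) :
    X ∈ Set.range transvection * (doubleTransvections K * doubleTransvections K) := by
  rcases eq_or_ne X 1 with rfl | hX1
  · exact mem_range_transvection_mul_of_mem one_mem_doubleTransvections_mul
  by_cases hX : ∀ v : Vec K, form v (X • v) = 0
  · obtain ⟨p, q, r, s, -, rfl⟩ := exists_eq_transvection_mul hX hX1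
    exact transvection_mul_mul_mem _ _ _
  push Not at hX
  obtain ⟨v, hv⟩ := hX
  obtain ⟨m, hm⟩ := exists_form_smul_eq_one hv
  obtain hX | ⟨q, s, b, c, d, e, h, hd⟩ := isSplit_or_isNonsplitBasis hm
  · exact hX.mem_range_transvection_mul
  generalize form (m • v) (X • X • m • v) = a at h hd
  rcases eq_or_ne d 0 with rfl | hd0
  · have hdet := h.det_eq_one
    obtain rfl : b = 1 := by grind [eq_zero_or_eq_one_of_card_eq_two hK b]
    obtain rfl : e = 1 := by grind
    obtain rfl : a = 0 := by grind
    exact h.mem_range_transvection_mul_of_eq_one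
  · exact h.mem_range_transvection_mul hd0

/-! ### Commutators -/

theorem commutator_transvection_mem_doubleTransvections {X : Sp4 K} {v x y : Vec K}
    (h : form v (X • v) = 0) (hXx : form (X • v) x ≠ 0) (hvx : form v x = 0)
    (hvy : form v y ≠ 0) : ⁅X, transvection v⁆ ∈ doubleTransvections K := by
  rw [commutatorElement_def, conj_transvection, transvection_inv]
  exact mem_doubleTransvections ((form_comm _ _).trans h) hXx hvx hvy

theorem IsSymplecticBasis.exists_commutator_mem {p q r s : Vec K}
    (hb : IsSymplecticBasis p q r s) (κ : K) :
    ∃ g : Sp4 K, ⁅transvection (κ • r) * transvection (p + r), g⁆ ∈ doubleTransvections K := by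
  have hb' : IsSymplecticBasis (p + q) q r (s + r) := by
    constructor <;> simp [hb.pairings, CharTwo.add_self_eq_zero]
  obtain ⟨g, hp, -, hr, -⟩ := hb.exists_smul_eq hb'
  refine ⟨g, ?_⟩
  have hcomm : ⁅transvection (κ • r) * transvection (p + r), g⁆ = transvection (κ • r) *
      (transvection (p + r) * transvection (p + q + r)) * (transvection (κ • r))⁻¹ := by
    have hconj : g * (transvection (p + r) * transvection (κ • r)) * g⁻¹ =
        transvection (p + q + r) * transvection (κ • r) := by
      rw [← conj_mul, conj_transvection, conj_transvection, smul_comm g, smul_add, hp, hr]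
    rw [commutatorElement_def, _root_.mul_inv_rev, transvection_inv, transvection_inv,
      mul_assoc _ g, mul_assoc _ (g * _), hconj]
    simp only [mul_assoc]
  rw [hcomm]
  refine conj_mem_doubleTransvections (mem_doubleTransvections (r := p + s) (s := s) ?_ ?_ ?_ ?_) _
    <;> simp [hb.pairings, CharTwo.add_self_eq_zero]

theorem IsSplit.exists_commutator_mem {X : Sp4 K} (hX : IsSplit X) :
    ∃ g : Sp4 K, ⁅X, g⁆ ∈ doubleTransvections K := by
  obtain ⟨p, q, r, s, hb, κ, l, rfl | rfl⟩ := hX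
  · exact hb.exists_commutator_mem κ
  have hv : (transvection (κ • r) * transvection (p + r) *
      (transvection (l • s) * transvection (q + s))) • (p + q) = r + s := by
    simp only [mul_smul, transvection_smul, smul_add, map_add, map_smul, LinearMap.add_apply,
      LinearMap.smul_apply, smul_eq_mul, hb.pairings]
    match_scalars <;> grind
  refine ⟨transvection (p + q),
    commutator_transvection_mem_doubleTransvections (x := q) (y := r) ?_ ?_ ?_ ?_⟩ <;>
  simp [hv, hb.pairings, CharTwo.add_self_eq_zero]

theorem IsNonsplitBasis.exists_commutator_mem [PerfectRing K 2] {X : Sp4 K}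
    {p q r s : Vec K} {a b c d e : K} (h : IsNonsplitBasis X p q r s a b c d e)
    (hd : d = 0 → a = b + e) : ∃ g : Sp4 K, ⁅X, g⁆ ∈ doubleTransvections K := by
  have hdet := h.det_eq_one
  rcases eq_or_ne d 0 with rfl | hd0
  · obtain rfl := hd rfl
    have hb : b ≠ 0 := by grind
    have hv : form (p + b • r) (X • (p + b • r)) = 0 := by
      simp only [h.smul_p, h.smul_r, smul_add, smul_comm X, map_add, map_smul,
        LinearMap.add_apply, LinearMap.smul_apply, smul_eq_mul, h.pairings]
      grind
    refine ⟨transvection (p + b • r),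
      commutator_transvection_mem_doubleTransvections (x := s) (y := r) hv ?_ ?_ ?_⟩ <;>
    simp [h.smul_p, h.smul_r, smul_comm X, h.pairings, hb]
  · obtain ⟨δ, rfl⟩ := exists_sq_eq d
    have hδ : δ ≠ 0 := ne_zero_pow two_ne_zero hd0
    have hv : form (δ • r + q) (X • (δ • r + q)) = 0 := by
      simp only [h.smul_q, h.smul_r, smul_add, smul_comm X, map_add, map_smul,
        LinearMap.add_apply, LinearMap.smul_apply, smul_eq_mul, h.pairings]
      grind
    refine ⟨transvection (δ • r + q),
      commutator_transvection_mem_doubleTransvections (x := q) (y := p) hv ?_ ?_ ?_⟩ <;>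
    simp [h.smul_q, h.smul_r, smul_comm X, h.pairings, hδ]

theorem exists_commutator_mem_doubleTransvections [PerfectRing K 2] {X : Sp4 K} (hX1 : X ≠ 1) :
    ∃ g : Sp4 K, ⁅X, g⁆ ∈ doubleTransvections K := by
  by_cases hX : ∀ v : Vec K, form v (X • v) = 0
  · obtain ⟨p, q, r, s, hb, rfl⟩ := exists_eq_transvection_mul hX hX1
    refine ⟨transvection p,
      commutator_transvection_mem_doubleTransvections (x := q) (y := r) (hX p) ?_ ?_ ?_⟩ <;>
    simp [mul_smul, transvection_smul, hb.pairings]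
  push Not at hX
  obtain ⟨v, hv⟩ := hX
  obtain ⟨m, hm⟩ := exists_form_smul_eq_one hv
  obtain hX | ⟨q, s, b, c, d, e, h, hd⟩ := isSplit_or_isNonsplitBasis hm
  · exact hX.exists_commutator_mem
  · exact h.exists_commutator_mem hd

end CharTwo

/-! ### The sign character over two elements -/

/-- The quadratic form over the field with two elements that polarizes to the standard alternating
form and differs from `x₁ y₁ + x₂ y₂` by the linear form `x ↦ a ⬝ᵥ x`. -/
def quadForm (a x : Vec (ZMod 2)) : ZMod 2 :=
  x (.inl 0) * x (.inr 0) + x (.inl 1) * x (.inr 1) + a ⬝ᵥ x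

/-- The quadratic forms on `𝔽₂⁴` that polarize to the standard alternating form and have Arf
invariant one, which is encoded as having exactly six zeros. -/
@[ext]
structure OddForm where
  toFun : Vec (ZMod 2) → ZMod 2
  map_add : ∀ x y, toFun (x + y) = toFun x + toFun y + form x y
  card_zeros : ({x | toFun x = 0} : Finset (Vec (ZMod 2))).card = 6

namespace OddForm

theorem quadForm_add (a x y : Vec (ZMod 2)) :
    quadForm a (x + y) = quadForm a x + quadForm a y + form x y := by
  simp only [quadForm, form_apply, Pi.add_apply, dotProduct_add]
  grind

theorem quadForm_injective : Function.Injective quadForm := fun a b h =>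
  dotProduct_eq a b fun x => add_left_cancel (congr_fun h x)

theorem exists_toFun_eq_quadForm (q : OddForm) : ∃ a, q.toFun = quadForm a := by
  let f : Module.Dual (ZMod 2) (Vec (ZMod 2)) := AddMonoidHom.toZModLinearMap 2
    (AddMonoidHom.mk' (fun x => q.toFun x + quadForm 0 x) fun x y => by
      simp only [q.map_add, quadForm_add]
      grind)
  obtain ⟨a, ha⟩ := (dotProductEquiv (ZMod 2) _).surjective f
  refine ⟨a, funext fun x => ?_⟩
  have hx : a ⬝ᵥ x = q.toFun x + quadForm 0 x := LinearMap.congr_fun ha x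
  rw [quadForm, hx, quadForm, zero_dotProduct]
  grind

instance : MulAction (Sp4 (ZMod 2)) OddForm where
  smul g q :=
    { toFun := fun x => q.toFun (g⁻¹ • x)
      map_add := fun x y => by rw [smul_add, q.map_add, form_smul_smul]
      card_zeros := by
        rw [← q.card_zeros]
        exact Finset.card_equiv (MulAction.toPerm g⁻¹) fun x => by simp }
  one_smul q := OddForm.ext (funext fun x => congr_arg q.toFun (by rw [inv_one, one_smul]))
  mul_smul g h q := OddForm.ext (funext fun x => congr_arg q.toFun (by
    rw [_root_.mul_inv_rev, mul_smul]))

theorem toFun_smul (g : Sp4 (ZMod 2)) (q : OddForm) (x : Vec (ZMod 2)) :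
    (g • q).toFun x = q.toFun (g⁻¹ • x) := rfl

theorem transvection_smul_eq_self_iff {v : Vec (ZMod 2)} (hv : v ≠ 0) (q : OddForm) :
    transvection v • q = q ↔ q.toFun v = 1 := by
  have hsmul (x : Vec (ZMod 2)) : (transvection v • q).toFun x = q.toFun (x + form v x • v) := by
    rw [toFun_smul, transvection_inv, transvection_smul]
  have hadd (x : Vec (ZMod 2)) (hx : form v x = 1) :
      q.toFun (x + form v x • v) = q.toFun x + (q.toFun v + 1) := by
    rw [hx, one_smul, q.map_add, form_comm x, hx, add_assoc]
  constructor
  · intro h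
    obtain ⟨x, hx⟩ := exists_form_eq_one hv
    have := hsmul x
    rw [h, hadd x hx, left_eq_add] at this
    exact CharTwo.add_eq_zero.1 this
  · refine fun h => OddForm.ext (funext fun x => (hsmul x).trans ?_)
    obtain hx | hx := eq_zero_or_eq_one_of_card_eq_two (Nat.card_zmod 2) (form v x)
    · rw [hx, zero_smul, add_zero]
    · rw [hadd x hx, h, CharTwo.add_self_eq_zero, add_zero]

theorem card_quadForm_eq_zero : ∀ v : Vec (ZMod 2), v ≠ 0 →
    ({a | ({x | quadForm a x = 0} : Finset (Vec (ZMod 2))).card = 6 ∧ quadForm a v = 0} :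
      Finset (Vec (ZMod 2))).card = 2 := by
  decide +kernel

instance : Finite OddForm :=
  Finite.of_injective OddForm.toFun fun _ _ => OddForm.ext

open Classical in
noncomputable instance : Fintype OddForm := Fintype.ofFinite _

open Classical in
theorem isSwap_toPerm_transvection {v : Vec (ZMod 2)} (hv : v ≠ 0) :
    (MulAction.toPerm (transvection v) : Equiv.Perm OddForm).IsSwap := by
  refine Equiv.Perm.card_support_eq_two.1 (Eq.trans ?_ (card_quadForm_eq_zero v hv))
  have hmem (q : OddForm) : q ∈ (MulAction.toPerm (transvection v)).support ↔ q.toFun v = 0 := by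
    rw [Equiv.Perm.mem_support, MulAction.toPerm_apply, Ne, transvection_smul_eq_self_iff hv]
    obtain h | h := eq_zero_or_eq_one_of_card_eq_two (Nat.card_zmod 2) (q.toFun v) <;> simp [h]
  refine (Finset.card_bij (fun a ha => ⟨quadForm a, quadForm_add a, (Finset.mem_filter.1 ha).2.1⟩)
    ?_ ?_ ?_).symm
  · intro a ha
    exact (hmem _).2 (Finset.mem_filter.1 ha).2.2
  · intro a _ b _ h
    exact quadForm_injective (congr_arg toFun h)
  · intro q hq
    obtain ⟨a, ha⟩ := q.exists_toFun_eq_quadForm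
    refine ⟨a, Finset.mem_filter.2 ⟨Finset.mem_univ _, ?_, ?_⟩, OddForm.ext ha.symm⟩
    · simpa only [ha] using q.card_zeros
    · simpa only [ha] using (hmem q).1 hq

end OddForm

section Map

variable {R S : Type*} [CommRing R] [CommRing S]

/-- The homomorphism `Sp₄(R) → Sp₄(S)` given by applying a ring homomorphism to the entries. -/
def map (f : R →+* S) : Sp4 R →* Sp4 S :=
  (f.mapMatrix.toMonoidHom.comp (Submonoid.subtype _)).codRestrict _
    fun A => SymplecticGroup.map_mem A.2 f

theorem map_smul_comp (f : R →+* S) (A : Sp4 R) (x : Vec R) : map f A • (f ∘ x) = f ∘ (A • x) :=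
  funext fun i => (f.map_mulVec A.1 x i).symm

theorem map_transvection (e : R ≃+* S) (v : Vec R) :
    map (e : R →+* S) (transvection v) = transvection (e ∘ v) :=
  ext_smul fun y => by
    obtain ⟨x, rfl⟩ : ∃ x, e ∘ x = y := ⟨e.symm ∘ y, funext fun i => e.apply_symm_apply (y i)⟩
    have hform : form (e ∘ v) (e ∘ x) = e (form v x) := by
      simp only [form_apply, Function.comp_apply, map_sub, map_add, map_mul]
    have hmap := map_smul_comp (e : R →+* S) (transvection v) x
    rw [RingEquiv.coe_toRingHom] at hmap
    rw [hmap, transvection_smul, transvection_smul, hform]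
    ext i
    simp

end Map

theorem exists_monoidHom_transvection_eq_neg_one {K : Type*} [Field K] (hK : Nat.card K = 2) :
    ∃ ε : Sp4 K →* ℤˣ, ∀ v ≠ 0, ε (transvection v) = -1 := by
  classical
  have : Finite K := Nat.finite_of_card_ne_zero (by rw [hK]; decide)
  have := Fintype.ofFinite K
  let e : K ≃+* ZMod 2 := FiniteField.ringEquivOfCardEq (by
    rw [← Nat.card_eq_fintype_card, hK, ZMod.card])
  refine ⟨(Equiv.Perm.sign.comp (MulAction.toPermHom (Sp4 (ZMod 2)) OddForm)).comp
    (map (e : K →+* ZMod 2)), fun v hv => ?_⟩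
  rw [MonoidHom.comp_apply, map_transvection]
  refine (OddForm.isSwap_toPerm_transvection fun h => hv (funext fun i => ?_)).sign_eq
  simpa using congr_fun h i

section Diameter

variable {K : Type*} [Field K] [CharP K 2] [PerfectRing K 2]

theorem doubleTransvections_mul_subset_conjWordBall {S : Set (Sp4 K)} {s : Sp4 K} (hs : s ∈ S)
    (hs1 : s ≠ 1) : doubleTransvections K * doubleTransvections K ⊆ conjWordBall S 4 := by
  obtain ⟨g, hg⟩ := exists_commutator_mem_doubleTransvections hs1
  rintro _ ⟨A, hA, B, hB, rfl⟩
  exact mul_mem_conjWordBall (m := 2) (n := 2)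
    (mem_conjWordBall_two_of_isConj_commutator hs (isConj_of_mem_doubleTransvections hg hA))
    (mem_conjWordBall_two_of_isConj_commutator hs (isConj_of_mem_doubleTransvections hg hB))

theorem deltaInfty_le_four (hK : Nat.card K ≠ 2) : deltaInfty (Sp4 K) ≤ 4 := by
  refine deltaInfty_le fun S hS => Set.eq_univ_of_forall fun X => ?_
  obtain ⟨s, hs, hs1⟩ := exists_mem_notMem_of_normalClosure_eq_top hS bot_ne_top
  exact doubleTransvections_mul_subset_conjWordBall hs hs1 (mem_doubleTransvections_mul hK X)

theorem mem_doubleTransvections_mul_of_apply_eq_one (hK : Nat.card K = 2) {ε : Sp4 K →* ℤˣ}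
    (hε : ∀ v ≠ 0, ε (transvection v) = -1) {X : Sp4 K} (hX : ε X = 1) :
    X ∈ doubleTransvections K * doubleTransvections K := by
  have hdouble {A : Sp4 K} (hA : A ∈ doubleTransvections K) : ε A = 1 := by
    obtain ⟨p, q, hpq, -, rfl⟩ := hA
    rw [map_mul, hε p (hpq.ne_zero 0), hε q (hpq.ne_zero 1), neg_mul_neg, one_mul]
  obtain ⟨_, ⟨v, rfl⟩, Y, hY, rfl⟩ := mem_range_transvection_mul hK X
  rcases eq_or_ne v 0 with rfl | hv
  · simpa only [transvection_zero, one_mul] using hY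
  · obtain ⟨A, hA, B, hB, rfl⟩ := hY
    simp only [map_mul, hε v hv, hdouble hA, hdouble hB] at hX
    exact absurd hX (by decide)

theorem deltaInfty_le_five (hK : Nat.card K = 2) : deltaInfty (Sp4 K) ≤ 5 := by
  obtain ⟨ε, hε⟩ := exists_monoidHom_transvection_eq_neg_one hK
  obtain ⟨v, hv⟩ := exists_ne (0 : Vec K)
  have hker : ε.ker ≠ ⊤ := fun h => by
    have := MonoidHom.mem_ker.1 (h ▸ Subgroup.mem_top (transvection v))
    rw [hε v hv] at this
    exact absurd this (by decide)
  refine deltaInfty_le fun S hS => Set.eq_univ_of_forall fun X => ?_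
  obtain ⟨s, hs, hsε⟩ := exists_mem_notMem_of_normalClosure_eq_top hS hker
  have hball {Y : Sp4 K} (hY : ε Y = 1) : Y ∈ conjWordBall S 4 :=
    doubleTransvections_mul_subset_conjWordBall hs (by rintro rfl; exact hsε ε.ker.one_mem)
      (mem_doubleTransvections_mul_of_apply_eq_one hK hε hY)
  rcases Int.units_eq_one_or (ε X) with hX | hX
  · exact conjWordBall_mono (by decide) (hball hX)
  · have hsX : ε (s⁻¹ * X) = 1 := by
      rw [map_mul, map_inv, hX, (Int.units_eq_one_or _).resolve_left hsε, inv_mul_cancel]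
    rw [← mul_inv_cancel_left s X]
    exact mul_mem_conjWordBall (m := 1) (n := 4)
      (mem_conjWordBall_one (.inl hs) (IsConj.refl s)) (hball hsX)

end Diameter

end Sp4

theorem exists_charP_two_perfectRing {K : Type*} [Field K] {n : ℕ} (hn : n ≠ 0)
    (hK : Nat.card K = 2 ^ n) : ∃ _ : CharP K 2, PerfectRing K 2 := by
  have : Finite K := Nat.finite_of_card_ne_zero (hK ▸ pow_ne_zero n two_ne_zero)
  have := Fintype.ofFinite K
  have hchar : ringChar K = 2 := FiniteField.even_card_iff_char_two.2
    (Nat.mod_eq_zero_of_dvd (by rw [← Nat.card_eq_fintype_card, hK]; exact dvd_pow_self 2 hn))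
  have := ringChar.of_eq hchar
  exact ⟨this, inferInstance⟩

theorem mainTheorem8_general (K : Type*) [Field K] [CharP K 2] [PerfectRing K 2] :
    (Nat.card K = 2 → deltaInfty (Sp4 K) ≤ 5) ∧ (Nat.card K ≠ 2 → deltaInfty (Sp4 K) ≤ 4) :=
  ⟨Sp4.deltaInfty_le_five, Sp4.deltaInfty_le_four⟩

theorem mainTheorem8 (K : Type*) [Field K] :
    (Nat.card K = 2 → deltaInfty (Sp4 K) ≤ 5) ∧
    (Nat.card K = 4 → deltaInfty (Sp4 K) ≤ 4) := by
  refine ⟨fun hK => ?_, fun hK => ?_⟩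
  · obtain ⟨_, _⟩ := exists_charP_two_perfectRing one_ne_zero hK
    exact (mainTheorem8_general K).1 hK
  · obtain ⟨_, _⟩ := exists_charP_two_perfectRing (n := 2) two_ne_zero hK
    exact (mainTheorem8_general K).2 (by rw [hK]; decide)
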